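/- Let $n\ge 1$, let $Y\in\mathbb{R}^{n\times M}$ be a matrix of $M$ target vectors (its columns) in $\mathbb{R}^n$, let $\bar Y$ be the $n\times M$ matrix all of whose columns equal the mean target, and assume that the sample covariance matrix $\Sigma=M^{-1}(Y-\bar Y)(Y-\bar Y)^T$ has full rank $n$. Let $V=\operatorname{diag}(\sigma_1^2,\dots,\sigma_n^2)$, where $\sigma_i^2$ is the sample variance of the $i$-th target component, and let $P=V^{-1/2}\Sigma V^{-1/2}$ be the sample correlation matrix. Denote by $\lambda_{\min}$ and $\bar\lambda$ the smallest and the average eigenvalue of $\Sigma$, and by $\tilde\lambda_{\min}$, $\tilde\lambda_{\max}$ the smallest and largest eigenvalue of $P$. Let $\lambda_H,\lambda_W\ge 0$, $c=\lambda_H\lambda_W$, and let $d$ be the feature dimension. Define three training errors of the unconstrained feature model ($H\in\mathbb{R}^{d\times M}$, $W\in\mathbb{R}^{n\times d}$, $b\in\mathbb{R}^n$): - $\mathrm{MSE}=M^{-1}\|WH+b\mathbf 1^T-Y\|_F^2$, where $(H,W,b)$ is a global minimizer of $\frac1{2M}\|WH+b\mathbf 1^T-Y\|_F^2+\frac{\lambda_H}{2M}\|H\|_F^2+\frac{\lambda_W}{2}\|W\|_F^2$;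 - $\mathrm{MSE}(\text{de-whiten})=M^{-1}\|\Sigma^{1/2}WH+\bar Y-Y\|_F^2$, where $(H,W)$ is a global minimizer of $\frac1{2M}\|WH-\Sigma^{-1/2}(Y-\bar Y)\|_F^2+\frac{\lambda_H}{2M}\|H\|_F^2+\frac{\lambda_W}{2}\|W\|_F^2$; - $\mathrm{MSE}(\text{de-normalize})=M^{-1}\|V^{1/2}WH+\bar Y-Y\|_F^2$, where $(H,W)$ is a global minimizer of $\frac1{2M}\|WH-V^{-1/2}(Y-\bar Y)\|_F^2+\frac{\lambda_H}{2M}\|H\|_F^2+\frac{\lambda_W}{2}\|W\|_F^2$. If $c>0$, all three minimization problems have global minimizers. Moreover, for every choice of the minimizers: (i) Suppose $d\ge n$ and $0<c<\min\{\lambda_{\min},\tilde\lambda_{\min}\}$. Then $\mathrm{MSE}(\text{de-normalize})=\mathrm{MSE}(\text{de-whiten})$. Furthermore, if $\bar\lambda<1$, then $\mathrm{MSE}(\text{de-normalize})<\mathrm{MSE}$; if $\bar\lambda>1$, then $\mathrm{MSE}(\text{de-normalize})>\mathrm{MSE}$; and if $\bar\lambda=1$, then $\mathrm{MSE}(\text{de-normalize})=\mathrm{MSE}$.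 (ii) Suppose $c>\tilde\lambda_{\max}$. Then $\mathrm{MSE}(\text{de-normalize})=\mathrm{MSE}(\text{de-whiten})$ and $\mathrm{MSE}(\text{de-normalize})\ge\mathrm{MSE}$. -/

import Mathlib

open scoped MatrixOrder

noncomputable section

namespace UFM

variable {n d M : ℕ}

/-- Squared Frobenius norm of a real matrix. -/
def frobSq {p q : ℕ} (A : Matrix (Fin p) (Fin q) ℝ) : ℝ := ∑ i, ∑ j, A i j ^ 2

/-! ### Statistics of the targets. The columns of `Y` are the `M` target vectors in `ℝⁿ`. -/

/-- The sample mean of each target component. -/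
def targetMean (Y : Matrix (Fin n) (Fin M) ℝ) (i : Fin n) : ℝ := (M : ℝ)⁻¹ * ∑ j, Y i j

/-- The matrix all of whose columns are the sample mean of the targets. -/
def meanMatrix (Y : Matrix (Fin n) (Fin M) ℝ) : Matrix (Fin n) (Fin M) ℝ :=
  Matrix.of fun i _ => targetMean Y i

/-- The sample covariance matrix of the targets. -/
def sampleCov (Y : Matrix (Fin n) (Fin M) ℝ) : Matrix (Fin n) (Fin n) ℝ :=
  (M : ℝ)⁻¹ • ((Y - meanMatrix Y) * (Y - meanMatrix Y).transpose)

/-- The sample variance of the `i`-th target component. -/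
def targetVar (Y : Matrix (Fin n) (Fin M) ℝ) (i : Fin n) : ℝ :=
  (M : ℝ)⁻¹ * ∑ j, (Y i j - targetMean Y i) ^ 2

/-- The matrix `V^{1/2}`, where `V` is the diagonal matrix of the target variances. -/
def stdMatrix (Y : Matrix (Fin n) (Fin M) ℝ) : Matrix (Fin n) (Fin n) ℝ :=
  Matrix.diagonal fun i => Real.sqrt (targetVar Y i)

/-- The matrix `V^{-1/2}`, where `V` is the diagonal matrix of the target variances. -/
def invStdMatrix (Y : Matrix (Fin n) (Fin M) ℝ) : Matrix (Fin n) (Fin n) ℝ :=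
  Matrix.diagonal fun i => (Real.sqrt (targetVar Y i))⁻¹

/-- The sample correlation matrix `V^{-1/2} Σ V^{-1/2}` of the targets. -/
def sampleCorr (Y : Matrix (Fin n) (Fin M) ℝ) : Matrix (Fin n) (Fin n) ℝ :=
  invStdMatrix Y * sampleCov Y * invStdMatrix Y

theorem sampleCov_isHermitian (Y : Matrix (Fin n) (Fin M) ℝ) : (sampleCov Y).IsHermitian := by
  simp [Matrix.IsHermitian, sampleCov, Matrix.conjTranspose_eq_transpose_of_trivial,
    Matrix.transpose_mul]

theorem sampleCorr_isHermitian (Y : Matrix (Fin n) (Fin M) ℝ) : (sampleCorr Y).IsHermitian := by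
  have h := sampleCov_isHermitian Y
  simp only [Matrix.IsHermitian, Matrix.conjTranspose_eq_transpose_of_trivial] at h ⊢
  simp [sampleCorr, invStdMatrix, Matrix.transpose_mul, h, Matrix.mul_assoc]

/-- Smallest eigenvalue of a symmetric matrix (of positive size). -/
def eigMin {A : Matrix (Fin n) (Fin n) ℝ} (hA : A.IsHermitian) : ℝ := ⨅ i, hA.eigenvalues i

/-- Largest eigenvalue of a symmetric matrix (of positive size). -/
def eigMax {A : Matrix (Fin n) (Fin n) ℝ} (hA : A.IsHermitian) : ℝ := ⨆ i, hA.eigenvalues i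

/-- Average eigenvalue of a symmetric matrix (of positive size), with multiplicity. -/
def eigAvg {A : Matrix (Fin n) (Fin n) ℝ} (hA : A.IsHermitian) : ℝ :=
  (∑ i, hA.eigenvalues i) / n

/-! ### The UFM with raw targets -/

/-- Predictions `W H + b 1ᵀ`. -/
def predict (H : Matrix (Fin d) (Fin M) ℝ) (W : Matrix (Fin n) (Fin d) ℝ) (b : Fin n → ℝ) :
    Matrix (Fin n) (Fin M) ℝ :=
  W * H + Matrix.vecMulVec b 1

/-- The UFM-loss with targets `Y` and regularization parameters `lH`, `lW`. -/
def loss (lH lW : ℝ) (Y : Matrix (Fin n) (Fin M) ℝ)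
    (H : Matrix (Fin d) (Fin M) ℝ) (W : Matrix (Fin n) (Fin d) ℝ) (b : Fin n → ℝ) : ℝ :=
  1 / (2 * M) * frobSq (predict H W b - Y) + lH / (2 * M) * frobSq H + lW / 2 * frobSq W

/-- `(H, W, b)` is a global minimizer of the UFM-loss. -/
def IsMinimizer (lH lW : ℝ) (Y : Matrix (Fin n) (Fin M) ℝ)
    (H : Matrix (Fin d) (Fin M) ℝ) (W : Matrix (Fin n) (Fin d) ℝ) (b : Fin n → ℝ) : Prop :=
  ∀ (H' : Matrix (Fin d) (Fin M) ℝ) (W' : Matrix (Fin n) (Fin d) ℝ) (b' : Fin n → ℝ),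
    loss lH lW Y H W b ≤ loss lH lW Y H' W' b'

/-- Mean squared error of predictions `Z` for targets `Y`. -/
def mse (Z Y : Matrix (Fin n) (Fin M) ℝ) : ℝ := (M : ℝ)⁻¹ * frobSq (Z - Y)

/-! ### The UFM without bias, used for transformed (hence centered) targets -/

/-- The UFM-loss without bias, for targets `Y`. -/
def lossNoBias (lH lW : ℝ) (Y : Matrix (Fin n) (Fin M) ℝ)
    (H : Matrix (Fin d) (Fin M) ℝ) (W : Matrix (Fin n) (Fin d) ℝ) : ℝ :=
  1 / (2 * M) * frobSq (W * H - Y) + lH / (2 * M) * frobSq H + lW / 2 * frobSq W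

/-- `(H, W)` is a global minimizer of the UFM-loss without bias. -/
def IsMinimizerNoBias (lH lW : ℝ) (Y : Matrix (Fin n) (Fin M) ℝ)
    (H : Matrix (Fin d) (Fin M) ℝ) (W : Matrix (Fin n) (Fin d) ℝ) : Prop :=
  ∀ (H' : Matrix (Fin d) (Fin M) ℝ) (W' : Matrix (Fin n) (Fin d) ℝ),
    lossNoBias lH lW Y H W ≤ lossNoBias lH lW Y H' W'

/-! ### Whitening and normalization of targets -/

/-- The ZCA-whitened targets `Σ^{-1/2} (Y - Ȳ)`. -/
def whiten (Y : Matrix (Fin n) (Fin M) ℝ) : Matrix (Fin n) (Fin M) ℝ :=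
  (CFC.sqrt (sampleCov Y))⁻¹ * (Y - meanMatrix Y)

/-- De-whitening `Σ^{1/2} Z + Ȳ` of predictions `Z` of the whitened targets. -/
def deWhiten (Y Z : Matrix (Fin n) (Fin M) ℝ) : Matrix (Fin n) (Fin M) ℝ :=
  CFC.sqrt (sampleCov Y) * Z + meanMatrix Y

/-- The normalized targets `V^{-1/2} (Y - Ȳ)`. -/
def normalize (Y : Matrix (Fin n) (Fin M) ℝ) : Matrix (Fin n) (Fin M) ℝ :=
  invStdMatrix Y * (Y - meanMatrix Y)

/-- De-normalization `V^{1/2} Z + Ȳ` of predictions `Z` of the normalized targets. -/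
def deNormalize (Y Z : Matrix (Fin n) (Fin M) ℝ) : Matrix (Fin n) (Fin M) ℝ :=
  stdMatrix Y * Z + meanMatrix Y

/-- `m` is the training MSE obtained from some optimal UFM (with feature dimension `d`)
for the raw targets. -/
def IsMSERaw (d : ℕ) (lH lW : ℝ) (Y : Matrix (Fin n) (Fin M) ℝ) (m : ℝ) : Prop :=
  ∃ (H : Matrix (Fin d) (Fin M) ℝ) (W : Matrix (Fin n) (Fin d) ℝ) (b : Fin n → ℝ),
    IsMinimizer lH lW Y H W b ∧ m = mse (predict H W b) Y

/-- `m` is the de-whitened training MSE obtained from some optimal UFM for the whitened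
targets. -/
def IsMSEDeWhiten (d : ℕ) (lH lW : ℝ) (Y : Matrix (Fin n) (Fin M) ℝ) (m : ℝ) : Prop :=
  ∃ (H : Matrix (Fin d) (Fin M) ℝ) (W : Matrix (Fin n) (Fin d) ℝ),
    IsMinimizerNoBias lH lW (whiten Y) H W ∧ m = mse (deWhiten Y (W * H)) Y

/-- `m` is the de-normalized training MSE obtained from some optimal UFM for the normalized
targets. -/
def IsMSEDeNormalize (d : ℕ) (lH lW : ℝ) (Y : Matrix (Fin n) (Fin M) ℝ) (m : ℝ) : Prop :=
  ∃ (H : Matrix (Fin d) (Fin M) ℝ) (W : Matrix (Fin n) (Fin d) ℝ),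
    IsMinimizerNoBias lH lW (normalize Y) H W ∧ m = mse (deNormalize Y (W * H)) Y

end UFM

end

namespace UFM

open Matrix

variable {n d M p q r : ℕ}

/-! Up to the factor $2M$, the bias-free loss is $\|WH-T\|^2+\lambda_H\|H\|^2+M\lambda_W\|W\|^2$.
For $Q$ with orthonormal rows the penalty is at least $2\langle WH,D\rangle$ with $D=\sqrt{cM}\,Q$
(`two_mul_frobInner_mul_le`), so the loss is at least $\|WH-(T-D)\|^2$ plus a constant, with
equality when $T-D$ has a balanced factorization. Taking $Q=UK$ from a singular value decomposition
$T=U\operatorname{diag}(s)K$, this is soft thresholding of the singular values; if $c$ is at most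
every eigenvalue of $M^{-1}TT^T$ and $d\ge n$, every minimizer has residual $-\sqrt{cM}\,Q$
(`IsMinimizerNoBias.exists_residual_eq`).

A back-transformation $B$ therefore gives error $c\|B\|_F^2$. For $B=I$ this is $cn$; for
$\Sigma^{1/2}$ and $V^{1/2}$ it is $c\operatorname{tr}\Sigma=cn\bar\lambda$ both times. Hence (i),
the comparison resting on $\bar\lambda$ against 1.

If $c$ is at least every eigenvalue, the minimizer predicts zero (`IsMinimizerNoBias.mul_eq_zero`).
In (ii) both transformed models thus return the mean, which the raw model can do as well.

The whitened covariance is $I$, and $\tilde\lambda_{\min}\le1\le\tilde\lambda_{\max}$ since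
$\operatorname{tr}P=n$, so conditions on $P$ cover whitening. The optimal bias only centers the
targets (`loss_eq_lossNoBias_add`). -/

/-! ### The Frobenius inner product -/

/-- The Frobenius inner product of two real matrices. -/
def frobInner (A B : Matrix (Fin p) (Fin q) ℝ) : ℝ := ∑ i, ∑ j, A i j * B i j

theorem frobInner_eq_trace (A B : Matrix (Fin p) (Fin q) ℝ) :
    frobInner A B = (A * Bᵀ).trace := by
  simp [frobInner, Matrix.trace, Matrix.mul_apply]

theorem frobSq_eq_trace (A : Matrix (Fin p) (Fin q) ℝ) : frobSq A = (A * Aᵀ).trace := by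
  simp [frobSq, Matrix.trace, Matrix.mul_apply, sq]

theorem frobSq_nonneg (A : Matrix (Fin p) (Fin q) ℝ) : 0 ≤ frobSq A :=
  Finset.sum_nonneg fun _ _ => Finset.sum_nonneg fun _ _ => sq_nonneg _

theorem sq_le_frobSq (A : Matrix (Fin p) (Fin q) ℝ) (i : Fin p) (j : Fin q) :
    A i j ^ 2 ≤ frobSq A :=
  (Finset.single_le_sum (f := fun j => A i j ^ 2) (fun _ _ => sq_nonneg _)
    (Finset.mem_univ j)).trans
  (Finset.single_le_sum (f := fun i => ∑ j, A i j ^ 2)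
    (fun _ _ => Finset.sum_nonneg fun _ _ => sq_nonneg _) (Finset.mem_univ i))

theorem eq_zero_of_frobSq_nonpos {A : Matrix (Fin p) (Fin q) ℝ} (h : frobSq A ≤ 0) : A = 0 := by
  ext i j
  have := (sq_le_frobSq A i j).trans h
  exact pow_eq_zero_iff two_ne_zero |>.1 (le_antisymm this (sq_nonneg _))

@[simp] theorem frobSq_zero : frobSq (0 : Matrix (Fin p) (Fin q) ℝ) = 0 := by
  simp [frobSq]

theorem frobSq_neg (A : Matrix (Fin p) (Fin q) ℝ) : frobSq (-A) = frobSq A := by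
  simp [frobSq]

theorem frobSq_smul (a : ℝ) (A : Matrix (Fin p) (Fin q) ℝ) :
    frobSq (a • A) = a ^ 2 * frobSq A := by
  simp [frobSq, mul_pow, Finset.mul_sum]

theorem frobSq_sub (A B : Matrix (Fin p) (Fin q) ℝ) :
    frobSq (A - B) = frobSq A - 2 * frobInner A B + frobSq B := by
  simp only [frobSq, frobInner, Finset.mul_sum, ← Finset.sum_sub_distrib,
    ← Finset.sum_add_distrib, Matrix.sub_apply]
  exact Finset.sum_congr rfl fun _ _ => Finset.sum_congr rfl fun _ _ => by ring

theorem frobInner_smul_right (a : ℝ) (A B : Matrix (Fin p) (Fin q) ℝ) :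
    frobInner A (a • B) = a * frobInner A B := by
  simp [frobInner_eq_trace]

theorem frobInner_smul_left (a : ℝ) (A B : Matrix (Fin p) (Fin q) ℝ) :
    frobInner (a • A) B = a * frobInner A B := by
  simp [frobInner_eq_trace]

theorem frobInner_sub_left (A B C : Matrix (Fin p) (Fin q) ℝ) :
    frobInner (A - B) C = frobInner A C - frobInner B C := by
  simp [frobInner_eq_trace, Matrix.sub_mul]

theorem frobInner_mul_left (W : Matrix (Fin p) (Fin r) ℝ) (H : Matrix (Fin r) (Fin q) ℝ)
    (T : Matrix (Fin p) (Fin q) ℝ) : frobInner (W * H) T = frobInner H (Wᵀ * T) := by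
  rw [frobInner_eq_trace, frobInner_eq_trace, Matrix.mul_assoc, Matrix.trace_mul_comm]
  simp [Matrix.mul_assoc]

theorem frobSq_transpose (A : Matrix (Fin p) (Fin q) ℝ) : frobSq Aᵀ = frobSq A := by
  simp only [frobSq, Matrix.transpose_apply]
  exact Finset.sum_comm

theorem frobSq_mul_of_mul_transpose_eq_one (A : Matrix (Fin p) (Fin r) ℝ)
    {Q : Matrix (Fin r) (Fin q) ℝ} (hQ : Q * Qᵀ = 1) : frobSq (A * Q) = frobSq A := by
  rw [frobSq_eq_trace, frobSq_eq_trace, Matrix.transpose_mul, Matrix.mul_assoc,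
    ← Matrix.mul_assoc Q, hQ, Matrix.one_mul]

/-! ### Minimizers of the loss without bias -/

theorem two_mul_lossNoBias (hM : 0 < M) (lH lW : ℝ) (T : Matrix (Fin n) (Fin M) ℝ)
    (H : Matrix (Fin d) (Fin M) ℝ) (W : Matrix (Fin n) (Fin d) ℝ) :
    2 * M * lossNoBias lH lW T H W =
      frobSq (W * H - T) + lH * frobSq H + M * lW * frobSq W := by
  have : (M : ℝ) ≠ 0 := by positivity
  unfold lossNoBias
  field_simp

/-- If `Q` has orthonormal rows, the regularization dominates twice the inner product of the
predictions with `√(lH lW M) Q`. -/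
theorem two_mul_frobInner_mul_le {lH lW : ℝ} (hlH : 0 ≤ lH) (hlW : 0 ≤ lW)
    (H : Matrix (Fin d) (Fin M) ℝ) (W : Matrix (Fin n) (Fin d) ℝ)
    {Q : Matrix (Fin n) (Fin M) ℝ} (hQ : Q * Qᵀ = 1) :
    2 * frobInner (W * H) (√(lH * lW * M) • Q) ≤ lH * frobSq H + M * lW * frobSq W := by
  -- Young's inequality after moving $W$ across the inner product; $\|W^TQ\|=\|W\|$ by
  -- orthonormality.
  have h := frobSq_nonneg (√lH • H - √(M * lW) • (Wᵀ * Q))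
  rw [frobSq_sub, frobSq_smul, frobSq_smul, frobInner_smul_left, frobInner_smul_right,
    frobSq_mul_of_mul_transpose_eq_one _ hQ, frobSq_transpose, Real.sq_sqrt hlH,
    Real.sq_sqrt (by positivity), ← frobInner_mul_left] at h
  rw [frobInner_smul_right, show lH * lW * M = lH * (M * lW) by ring, Real.sqrt_mul hlH]
  linarith

/-- If the shrunken targets `T - √(lH lW M) Q` can be factored in a balanced way, then they are
the predictions of every minimizer. -/
theorem IsMinimizerNoBias.residual_eq_of_balanced {lH lW : ℝ} (hM : 0 < M) (hlH : 0 ≤ lH)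
    (hlW : 0 ≤ lW) {T Q : Matrix (Fin n) (Fin M) ℝ} (hQ : Q * Qᵀ = 1)
    {H₀ : Matrix (Fin d) (Fin M) ℝ} {W₀ : Matrix (Fin n) (Fin d) ℝ}
    (hWH : W₀ * H₀ = T - √(lH * lW * M) • Q) (hbal : √lH • H₀ = √(M * lW) • (W₀ᵀ * Q))
    {H : Matrix (Fin d) (Fin M) ℝ} {W : Matrix (Fin n) (Fin d) ℝ}
    (h : IsMinimizerNoBias lH lW T H W) : W * H - T = -(√(lH * lW * M) • Q) := by
  set D := √(lH * lW * M) • Q with hD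
  -- Since $T=W_0H_0+D$, the quadratic term is recentered at $W_0H_0$, leaving a linear term that
  -- the penalty dominates.
  have hexp (H' : Matrix (Fin d) (Fin M) ℝ) (W' : Matrix (Fin n) (Fin d) ℝ) :
      frobSq (W' * H' - T) = frobSq (W' * H' - W₀ * H₀) - 2 * frobInner (W' * H') D
        + 2 * frobInner (W₀ * H₀) D + frobSq D := by
    rw [show W' * H' - T = (W' * H' - W₀ * H₀) - D by rw [hWH]; abel, frobSq_sub,
      frobInner_sub_left]
    ring
  -- Balance is the equality case of `two_mul_frobInner_mul_le`.
  have hreg : lH * frobSq H₀ + M * lW * frobSq W₀ = 2 * frobInner (W₀ * H₀) D := by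
    have h0 : frobSq (√lH • H₀ - √(M * lW) • (W₀ᵀ * Q)) = 0 := by rw [hbal]; simp
    rw [frobSq_sub, frobSq_smul, frobSq_smul, frobInner_smul_left, frobInner_smul_right,
      frobSq_mul_of_mul_transpose_eq_one _ hQ, frobSq_transpose, Real.sq_sqrt hlH,
      Real.sq_sqrt (by positivity), ← frobInner_mul_left] at h0
    rw [hD, frobInner_smul_right, show lH * lW * M = lH * (M * lW) by ring, Real.sqrt_mul hlH]
    linarith
  have hle := mul_le_mul_of_nonneg_left (h H₀ W₀) (by positivity : (0 : ℝ) ≤ 2 * M)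
  rw [two_mul_lossNoBias hM, two_mul_lossNoBias hM, hexp, hexp] at hle
  have hlow := two_mul_frobInner_mul_le hlH hlW H W hQ
  rw [sub_self, frobSq_zero] at hle
  have hz := eq_zero_of_frobSq_nonpos (A := W * H - W₀ * H₀) (by linarith)
  rw [sub_eq_zero.1 hz, hWH]
  abel

/-- Singular value decomposition of a matrix with positive definite Gram matrix. -/
theorem exists_singular_decomposition (hM : 0 < M) {T : Matrix (Fin n) (Fin M) ℝ}
    {S : Matrix (Fin n) (Fin n) ℝ} (hTS : (M : ℝ)⁻¹ • (T * Tᵀ) = S)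
    (hS : S.IsHermitian) (hpos : ∀ i, 0 < hS.eigenvalues i) :
    ∃ (U : Matrix (Fin n) (Fin n) ℝ) (K : Matrix (Fin n) (Fin M) ℝ),
      Uᵀ * U = 1 ∧ U * Uᵀ = 1 ∧ K * Kᵀ = 1 ∧
      T = U * diagonal (fun i => √(M * hS.eigenvalues i)) * K := by
  have hM' : (0 : ℝ) < M := by exact_mod_cast hM
  set U : Matrix (Fin n) (Fin n) ℝ := hS.eigenvectorUnitary.val with hU
  have hUU : Uᵀ * U = 1 := by
    have := Unitary.coe_star_mul_self hS.eigenvectorUnitary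
    rwa [Matrix.star_eq_conjTranspose, conjTranspose_eq_transpose_of_trivial] at this
  have hUU' : U * Uᵀ = 1 := mul_eq_one_comm.1 hUU
  have hspec : S = U * diagonal hS.eigenvalues * Uᵀ := by
    have := hS.spectral_theorem
    rw [Unitary.conjStarAlgAut_apply, Matrix.star_eq_conjTranspose,
      conjTranspose_eq_transpose_of_trivial] at this
    exact this
  set s : Fin n → ℝ := fun i => √(M * hS.eigenvalues i) with hs
  have hs0 (i : Fin n) : s i ≠ 0 := (Real.sqrt_pos.2 (mul_pos hM' (hpos i))).ne'
  have hinv : diagonal s * diagonal s⁻¹ = 1 := by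
    rw [diagonal_mul_diagonal, ← diagonal_one]
    exact congrArg diagonal (funext fun i => mul_inv_cancel₀ (hs0 i))
  have hTT : T * Tᵀ = U * (diagonal s * diagonal s) * Uᵀ := by
    have hss : diagonal s * diagonal s = (M : ℝ) • diagonal hS.eigenvalues := by
      rw [diagonal_mul_diagonal, ← diagonal_smul]
      exact congrArg diagonal (funext fun i => Real.mul_self_sqrt (mul_pos hM' (hpos i)).le)
    rw [hss, Matrix.mul_smul, Matrix.smul_mul, ← hspec, ← hTS, smul_smul,
      mul_inv_cancel₀ hM'.ne', one_smul]
  -- $K$ is forced by the required factorization; its rows are orthonormal because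
  -- $TT^T=U\operatorname{diag}(s)^2U^T$.
  refine ⟨U, diagonal s⁻¹ * Uᵀ * T, hUU, hUU', ?_, ?_⟩
  · calc _ = diagonal s⁻¹ * Uᵀ * (T * Tᵀ) * U * diagonal s⁻¹ := by
          simp [Matrix.mul_assoc]
      _ = diagonal s⁻¹ * (Uᵀ * U) * diagonal s * diagonal s * (Uᵀ * U) * diagonal s⁻¹ := by
          rw [hTT]
          simp only [Matrix.mul_assoc]
      _ = 1 := by
          rw [hUU, Matrix.mul_one, Matrix.mul_one, mul_eq_one_comm.1 hinv, Matrix.one_mul, hinv]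
  · calc T = U * Uᵀ * T := by rw [hUU', Matrix.one_mul]
      _ = U * (diagonal s * diagonal s⁻¹) * Uᵀ * T := by rw [hinv, Matrix.mul_one]
      _ = _ := by simp only [Matrix.mul_assoc]

/-- Weak regularization: the residual of a minimizer has orthogonal rows of equal length. -/
theorem IsMinimizerNoBias.exists_residual_eq {lH lW : ℝ} (hM : 0 < M) (hlH : 0 < lH)
    (hlW : 0 < lW) (hnd : n ≤ d) {T : Matrix (Fin n) (Fin M) ℝ} {S : Matrix (Fin n) (Fin n) ℝ}
    (hTS : (M : ℝ)⁻¹ • (T * Tᵀ) = S) (hS : S.IsHermitian) (hc : ∀ i, lH * lW ≤ hS.eigenvalues i)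
    {H : Matrix (Fin d) (Fin M) ℝ} {W : Matrix (Fin n) (Fin d) ℝ}
    (h : IsMinimizerNoBias lH lW T H W) :
    ∃ Q : Matrix (Fin n) (Fin M) ℝ, Q * Qᵀ = 1 ∧ W * H - T = -(√(lH * lW * M) • Q) := by
  have hM' : (0 : ℝ) < M := by exact_mod_cast hM
  obtain ⟨U, K, hUU, hUU', hK, hT⟩ := exists_singular_decomposition hM hTS hS
    fun i => (mul_pos hlH hlW).trans_le (hc i)
  set s : Fin n → ℝ := fun i => √(M * hS.eigenvalues i) with hs
  set t : ℝ := √(lH * lW * M) with ht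
  -- The ratio for which $H_0=kW_0^TQ$ is balanced.
  set k : ℝ := √(M * lW) / √lH with hk
  have hk0 : 0 < k := div_pos (Real.sqrt_pos.2 (by positivity)) (Real.sqrt_pos.2 hlH)
  have hQ : (U * K) * (U * K)ᵀ = 1 := by
    rw [Matrix.transpose_mul, Matrix.mul_assoc, ← Matrix.mul_assoc K, hK, Matrix.one_mul, hUU']
  -- The product $W_0H_0$ becomes $U\operatorname{diag}(ka^2)K$, so $ka^2=s-t$ is needed; `hc` makes
  -- this nonnegative.
  set a : Fin n → ℝ := fun i => √((s i - t) / k) with ha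
  have ha2 (i) : a i * a i = (s i - t) / k := by
    refine Real.mul_self_sqrt (div_nonneg (sub_nonneg.2 (Real.sqrt_le_sqrt ?_)) hk0.le)
    rw [mul_comm]
    exact mul_le_mul_of_nonneg_left (hc i) hM'.le
  -- Embeds $n$ coordinates into the $d$ features, which is where $n\le d$ enters.
  set E : Matrix (Fin n) (Fin d) ℝ :=
    (1 : Matrix (Fin d) (Fin d) ℝ).submatrix (Fin.castLE hnd) id with hE
  have hEE : E * Eᵀ = 1 := by
    rw [hE, Matrix.transpose_submatrix, Matrix.transpose_one,
      ← Matrix.submatrix_mul _ _ _ id _ Function.bijective_id, Matrix.one_mul]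
    exact Matrix.submatrix_one _ (Fin.castLE_injective hnd)
  refine ⟨U * K, hQ, h.residual_eq_of_balanced hM hlH.le hlW.le hQ
    (W₀ := U * diagonal a * E) (H₀ := k • ((U * diagonal a * E)ᵀ * (U * K))) ?_ ?_⟩
  · calc _ = k • (U * diagonal a * (E * Eᵀ) * diagonal a * (Uᵀ * U) * K) := by
          simp [Matrix.mul_assoc]
      _ = U * (k • (diagonal a * diagonal a)) * K := by
          rw [hEE, hUU]
          simp [Matrix.mul_assoc]
      _ = U * (diagonal s - t • 1) * K := by
          congr 2
          ext i j
          by_cases hij : i = j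
          · subst hij
            simp [diagonal_mul_diagonal, ha2]
            field_simp
          · simp [diagonal_mul_diagonal, hij]
      _ = _ := by
          rw [hT, Matrix.mul_sub, Matrix.sub_mul, Matrix.mul_smul, Matrix.smul_mul,
            Matrix.mul_one]
  · rw [smul_smul, hk, mul_div_cancel₀ _ (Real.sqrt_pos.2 hlH).ne']

/-- Strong regularization: the predictions of a minimizer vanish. -/
theorem IsMinimizerNoBias.mul_eq_zero {lH lW : ℝ} (hM : 0 < M) (hlH : 0 < lH)
    {T : Matrix (Fin n) (Fin M) ℝ} {S : Matrix (Fin n) (Fin n) ℝ}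
    (hTS : (M : ℝ)⁻¹ • (T * Tᵀ) = S) (hS : S.IsHermitian)
    (hc : ∀ i, hS.eigenvalues i ≤ lH * lW)
    {H : Matrix (Fin d) (Fin M) ℝ} {W : Matrix (Fin n) (Fin d) ℝ}
    (h : IsMinimizerNoBias lH lW T H W) : W * H = 0 := by
  have hM' : (0 : ℝ) < M := by exact_mod_cast hM
  have hTT : T * Tᵀ = (M : ℝ) • S := by
    rw [← hTS, smul_smul, mul_inv_cancel₀ hM'.ne', one_smul]
  have hpsd : ((lH * lW) • (1 : Matrix (Fin n) (Fin n) ℝ) - S).PosSemidef := by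
    set U : Matrix (Fin n) (Fin n) ℝ := hS.eigenvectorUnitary.val with hU
    have hUU' : U * Uᴴ = 1 := Unitary.coe_mul_star_self hS.eigenvectorUnitary
    have hspec : S = U * diagonal hS.eigenvalues * Uᴴ := by
      have := hS.spectral_theorem
      rwa [Unitary.conjStarAlgAut_apply, Matrix.star_eq_conjTranspose] at this
    have : (lH * lW) • (1 : Matrix (Fin n) (Fin n) ℝ) - S =
        U * diagonal (fun i => lH * lW - hS.eigenvalues i) * Uᴴ := by
      have hd : diagonal (fun i => lH * lW - hS.eigenvalues i) =
          (lH * lW) • (1 : Matrix (Fin n) (Fin n) ℝ) - diagonal hS.eigenvalues := by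
        rw [← diagonal_one, ← diagonal_smul, diagonal_sub]
        simp
      rw [hd, Matrix.mul_sub, Matrix.sub_mul, ← hspec, Matrix.mul_smul, Matrix.smul_mul,
        Matrix.mul_one, hUU']
    rw [this]
    exact (PosSemidef.diagonal fun i => sub_nonneg.2 (hc i)).mul_mul_conjTranspose_same U
  have hWT : frobSq (Wᵀ * T) ≤ M * (lH * lW) * frobSq W := by
    have h1 : 0 ≤ (Wᵀ * ((lH * lW) • (1 : Matrix (Fin n) (Fin n) ℝ) - S) * W).trace := by
      have := (hpsd.conjTranspose_mul_mul_same W).trace_nonneg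
      rwa [conjTranspose_eq_transpose_of_trivial] at this
    have h2 : frobSq (Wᵀ * T) = M * (Wᵀ * S * W).trace := by
      rw [frobSq_eq_trace, Matrix.transpose_mul, Matrix.mul_assoc, ← Matrix.mul_assoc T, hTT]
      simp [Matrix.mul_assoc]
    have h3 : frobSq W = (Wᵀ * W).trace := by
      rw [← frobSq_transpose, frobSq_eq_trace, Matrix.transpose_transpose]
    rw [Matrix.mul_sub, Matrix.sub_mul, Matrix.trace_sub, Matrix.mul_smul, Matrix.smul_mul,
      Matrix.mul_one, Matrix.trace_smul, ← h3, smul_eq_mul] at h1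
    rw [h2]
    nlinarith
  -- Young's inequality for $2\langle H,W^TT\rangle$, multiplied by $\lambda_H$ to avoid division;
  -- `hWT` turns $\|W^TT\|^2$ into the penalty on $W$.
  have hsq := frobSq_nonneg (lH • H - Wᵀ * T)
  rw [frobSq_sub, frobSq_smul, frobInner_smul_left, ← frobInner_mul_left] at hsq
  -- The zero model is the competitor.
  have hle := mul_le_mul_of_nonneg_left (h 0 0) (by positivity : (0 : ℝ) ≤ 2 * M)
  rw [two_mul_lossNoBias hM, two_mul_lossNoBias hM, frobSq_sub, Matrix.zero_mul, zero_sub,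
    frobSq_neg] at hle
  simp only [frobSq_zero, mul_zero, add_zero] at hle
  refine eq_zero_of_frobSq_nonpos ?_
  have : 2 * frobInner (W * H) T ≤ lH * frobSq H + M * lW * frobSq W := by
    refine le_of_mul_le_mul_left ?_ hlH
    nlinarith
  linarith

/-! ### Existence of minimizers by coercivity -/

theorem exists_isCompact_of_frobSq_le (p q : ℕ) (B : ℝ) :
    ∃ K : Set (Matrix (Fin p) (Fin q) ℝ), IsCompact K ∧ ∀ A, frobSq A ≤ B → A ∈ K := by
  refine ⟨Set.univ.pi fun _ => Set.univ.pi fun _ => Set.Icc (-√B) √B,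
    isCompact_univ_pi fun _ => isCompact_univ_pi fun _ => isCompact_Icc, fun A hA i _ j _ => ?_⟩
  exact abs_le.1 (Real.abs_le_sqrt ((sq_le_frobSq A i j).trans hA))

theorem continuous_frobSq (p q : ℕ) :
    Continuous (frobSq : Matrix (Fin p) (Fin q) ℝ → ℝ) :=
  continuous_finsetSum _ fun i _ => continuous_finsetSum _ fun j _ =>
    (continuous_id.matrix_elem i j).pow 2

theorem continuous_lossNoBias (lH lW : ℝ) (T : Matrix (Fin n) (Fin M) ℝ) :
    Continuous fun x : Matrix (Fin d) (Fin M) ℝ × Matrix (Fin n) (Fin d) ℝ =>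
      lossNoBias lH lW T x.1 x.2 := by
  have h1 := (continuous_frobSq n M).comp (((continuous_snd (X := Matrix (Fin d) (Fin M) ℝ)
    (Y := Matrix (Fin n) (Fin d) ℝ)).matrix_mul continuous_fst).sub (continuous_const (y := T)))
  have h2 := (continuous_frobSq d M).comp (continuous_fst (X := Matrix (Fin d) (Fin M) ℝ)
    (Y := Matrix (Fin n) (Fin d) ℝ))
  have h3 := (continuous_frobSq n d).comp (continuous_snd (X := Matrix (Fin d) (Fin M) ℝ)
    (Y := Matrix (Fin n) (Fin d) ℝ))
  exact ((continuous_const.mul h1).add (continuous_const.mul h2)).add (continuous_const.mul h3)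

/-- The loss without bias attains its minimum. -/
theorem exists_isMinimizerNoBias (d : ℕ) {lH lW : ℝ} (hM : 0 < M) (hlH : 0 < lH) (hlW : 0 < lW)
    (T : Matrix (Fin n) (Fin M) ℝ) :
    ∃ (H : Matrix (Fin d) (Fin M) ℝ) (W : Matrix (Fin n) (Fin d) ℝ),
      IsMinimizerNoBias lH lW T H W := by
  have hM' : (0 : ℝ) < M := by exact_mod_cast hM
  have hT := frobSq_nonneg T
  -- Beyond these radii one penalty alone exceeds $\|T\|^2$, the rescaled loss of the zero model.
  obtain ⟨K₁, hK₁, hmem₁⟩ := exists_isCompact_of_frobSq_le d M (frobSq T / lH)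
  obtain ⟨K₂, hK₂, hmem₂⟩ := exists_isCompact_of_frobSq_le n d (frobSq T / (M * lW))
  have h0mem : ((0, 0) : Matrix (Fin d) (Fin M) ℝ × Matrix (Fin n) (Fin d) ℝ) ∈ K₁ ×ˢ K₂ :=
    ⟨hmem₁ _ (by rw [frobSq_zero]; positivity), hmem₂ _ (by rw [frobSq_zero]; positivity)⟩
  obtain ⟨⟨H, W⟩, -, hmin⟩ := (hK₁.prod hK₂).exists_isMinOn ⟨_, h0mem⟩
    (continuous_lossNoBias lH lW T).continuousOn
  replace hmin (H' : Matrix (Fin d) (Fin M) ℝ) (W' : Matrix (Fin n) (Fin d) ℝ)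
      (h' : (H', W') ∈ K₁ ×ˢ K₂) : lossNoBias lH lW T H W ≤ lossNoBias lH lW T H' W' :=
    isMinOn_iff.1 hmin (H', W') h'
  refine ⟨H, W, fun H' W' => ?_⟩
  by_cases hx : (H', W') ∈ K₁ ×ˢ K₂
  · exact hmin H' W' hx
  refine (hmin 0 0 h0mem).trans ?_
  by_contra! hlt
  replace hlt := mul_lt_mul_of_pos_left hlt (by positivity : (0 : ℝ) < 2 * M)
  rw [two_mul_lossNoBias hM, two_mul_lossNoBias hM, Matrix.zero_mul, zero_sub, frobSq_neg] at hlt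
  simp only [frobSq_zero, mul_zero, add_zero] at hlt
  have h1 := frobSq_nonneg (W' * H' - T)
  have h2 := mul_nonneg hlH.le (frobSq_nonneg H')
  have h3 := mul_nonneg (mul_pos hM' hlW).le (frobSq_nonneg W')
  refine hx ⟨hmem₁ _ ?_, hmem₂ _ ?_⟩
  · rw [le_div_iff₀ hlH]
    linarith
  · rw [le_div_iff₀ (by positivity)]
    linarith

/-! ### Reduction of the loss with bias to the loss without bias -/

/-- Pythagoras: centered rows are orthogonal to constant rows. -/
theorem frobSq_eq_add_meanMatrix (hM : 0 < M) (A : Matrix (Fin p) (Fin M) ℝ) :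
    frobSq A = frobSq (A - meanMatrix A) + frobSq (meanMatrix A) := by
  have hM' : (M : ℝ) ≠ 0 := by positivity
  simp only [frobSq, ← Finset.sum_add_distrib]
  refine Finset.sum_congr rfl fun i _ => ?_
  have hmean : ∑ j, A i j = M * targetMean A i := by
    rw [targetMean, mul_inv_cancel_left₀ hM']
  have hexp (j) : (A - meanMatrix A) i j ^ 2 + meanMatrix A i j ^ 2 =
      A i j ^ 2 - 2 * targetMean A i * A i j + 2 * targetMean A i ^ 2 := by
    simp only [meanMatrix, Matrix.sub_apply, Matrix.of_apply]
    ring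
  simp only [hexp, Finset.sum_add_distrib, Finset.sum_sub_distrib, ← Finset.mul_sum, hmean]
  simp
  ring

theorem targetMean_predict_sub (hM : 0 < M) (Y : Matrix (Fin n) (Fin M) ℝ)
    (H : Matrix (Fin d) (Fin M) ℝ) (W : Matrix (Fin n) (Fin d) ℝ) (b : Fin n → ℝ) (i : Fin n) :
    targetMean (predict H W b - Y) i = ∑ k, W i k * targetMean H k + b i - targetMean Y i := by
  have hM' : (M : ℝ) ≠ 0 := by positivity
  simp only [targetMean, predict, Matrix.sub_apply, Matrix.add_apply, Matrix.mul_apply,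
    Matrix.vecMulVec_apply, Pi.one_apply, mul_one, Finset.sum_sub_distrib, Finset.sum_add_distrib]
  rw [Finset.sum_comm]
  simp only [← Finset.mul_sum, Finset.sum_const, Finset.card_univ, Fintype.card_fin, nsmul_eq_mul]
  have : ∑ k, W i k * ((M : ℝ)⁻¹ * ∑ j, H k j) = (M : ℝ)⁻¹ * ∑ k, W i k * ∑ j, H k j := by
    rw [Finset.mul_sum]
    exact Finset.sum_congr rfl fun _ _ => by ring
  rw [this]
  field_simp

theorem predict_sub_sub_meanMatrix (hM : 0 < M) (Y : Matrix (Fin n) (Fin M) ℝ)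
    (H : Matrix (Fin d) (Fin M) ℝ) (W : Matrix (Fin n) (Fin d) ℝ) (b : Fin n → ℝ) :
    predict H W b - Y - meanMatrix (predict H W b - Y) =
      W * (H - meanMatrix H) - (Y - meanMatrix Y) := by
  ext i j
  rw [Matrix.mul_sub]
  simp only [Matrix.sub_apply, meanMatrix, Matrix.of_apply, targetMean_predict_sub hM,
    Matrix.mul_apply]
  simp only [predict, Matrix.add_apply, Matrix.mul_apply, Matrix.vecMulVec_apply, Pi.one_apply]
  ring

/-- Pythagoras for the residual and for $H$. The bias affects only the mean residual, so it can be
optimized separately. -/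
theorem loss_eq_lossNoBias_add (hM : 0 < M) (lH lW : ℝ) (Y : Matrix (Fin n) (Fin M) ℝ)
    (H : Matrix (Fin d) (Fin M) ℝ) (W : Matrix (Fin n) (Fin d) ℝ) (b : Fin n → ℝ) :
    loss lH lW Y H W b = lossNoBias lH lW (Y - meanMatrix Y) (H - meanMatrix H) W +
      1 / (2 * M) * frobSq (meanMatrix (predict H W b - Y)) +
      lH / (2 * M) * frobSq (meanMatrix H) := by
  rw [loss, lossNoBias, frobSq_eq_add_meanMatrix hM (predict H W b - Y),
    frobSq_eq_add_meanMatrix hM H, predict_sub_sub_meanMatrix hM]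
  ring

theorem predict_targetMean (Y : Matrix (Fin n) (Fin M) ℝ) (H : Matrix (Fin d) (Fin M) ℝ)
    (W : Matrix (Fin n) (Fin d) ℝ) : predict H W (targetMean Y) = W * H + meanMatrix Y := by
  ext i j
  simp [predict, meanMatrix]

theorem loss_targetMean (lH lW : ℝ) (Y : Matrix (Fin n) (Fin M) ℝ)
    (H : Matrix (Fin d) (Fin M) ℝ) (W : Matrix (Fin n) (Fin d) ℝ) :
    loss lH lW Y H W (targetMean Y) = lossNoBias lH lW (Y - meanMatrix Y) H W := by
  rw [loss, lossNoBias, predict_targetMean,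
    show W * H + meanMatrix Y - Y = W * H - (Y - meanMatrix Y) by abel]

theorem lossNoBias_centered_le_loss (hM : 0 < M) {lH : ℝ} (hlH : 0 ≤ lH) (lW : ℝ)
    (Y : Matrix (Fin n) (Fin M) ℝ) (H : Matrix (Fin d) (Fin M) ℝ) (W : Matrix (Fin n) (Fin d) ℝ)
    (b : Fin n → ℝ) :
    lossNoBias lH lW (Y - meanMatrix Y) (H - meanMatrix H) W ≤ loss lH lW Y H W b := by
  rw [loss_eq_lossNoBias_add hM]
  have h1 := mul_nonneg (by positivity : (0 : ℝ) ≤ 1 / (2 * M))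
    (frobSq_nonneg (meanMatrix (predict H W b - Y)))
  have h2 := mul_nonneg (by positivity : (0 : ℝ) ≤ lH / (2 * M)) (frobSq_nonneg (meanMatrix H))
  linarith

theorem IsMinimizerNoBias.isMinimizer {lH lW : ℝ} (hM : 0 < M) (hlH : 0 ≤ lH)
    {Y : Matrix (Fin n) (Fin M) ℝ} {H : Matrix (Fin d) (Fin M) ℝ} {W : Matrix (Fin n) (Fin d) ℝ}
    (h : IsMinimizerNoBias lH lW (Y - meanMatrix Y) H W) :
    IsMinimizer lH lW Y H W (targetMean Y) := fun H' W' b' => by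
  rw [loss_targetMean]
  exact (h _ _).trans (lossNoBias_centered_le_loss hM hlH lW Y H' W' b')

theorem IsMinimizer.centered {lH lW : ℝ} (hM : 0 < M) (hlH : 0 ≤ lH)
    {Y : Matrix (Fin n) (Fin M) ℝ} {H : Matrix (Fin d) (Fin M) ℝ} {W : Matrix (Fin n) (Fin d) ℝ}
    {b : Fin n → ℝ} (h : IsMinimizer lH lW Y H W b) :
    IsMinimizerNoBias lH lW (Y - meanMatrix Y) (H - meanMatrix H) W := fun H' W' => by
  rw [← loss_targetMean _ _ _ H']
  exact (lossNoBias_centered_le_loss hM hlH lW Y H W b).trans (h _ _ _)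

/-- Centering $H$ and using the mean target as bias removes both mean terms, so optimality forces
the mean residual to vanish. The mean of $H$ may survive when $\lambda_H=0$, hence the centered $H$
on the right. -/
theorem IsMinimizer.predict_sub {lH lW : ℝ} (hM : 0 < M) (hlH : 0 ≤ lH)
    {Y : Matrix (Fin n) (Fin M) ℝ} {H : Matrix (Fin d) (Fin M) ℝ} {W : Matrix (Fin n) (Fin d) ℝ}
    {b : Fin n → ℝ} (h : IsMinimizer lH lW Y H W b) :
    predict H W b - Y = W * (H - meanMatrix H) - (Y - meanMatrix Y) := by
  have hM' : (0 : ℝ) < M := by exact_mod_cast hM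
  have hle := h (H - meanMatrix H) W (targetMean Y)
  rw [loss_targetMean, loss_eq_lossNoBias_add hM] at hle
  have h2 := mul_nonneg (by positivity : (0 : ℝ) ≤ lH / (2 * M)) (frobSq_nonneg (meanMatrix H))
  have hz : meanMatrix (predict H W b - Y) = 0 := by
    refine eq_zero_of_frobSq_nonpos ?_
    have hpos : (0 : ℝ) < 1 / (2 * M) := by positivity
    refine nonpos_of_mul_nonpos_right ?_ hpos
    linarith
  have := predict_sub_sub_meanMatrix hM Y H W b
  rwa [hz, sub_zero] at this

/-! ### Statistics of the targets -/

theorem sampleCov_diag (Y : Matrix (Fin n) (Fin M) ℝ) (i : Fin n) :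
    sampleCov Y i i = targetVar Y i := by
  simp [sampleCov, targetVar, Matrix.mul_apply, meanMatrix, sq]

theorem sampleCov_posSemidef (Y : Matrix (Fin n) (Fin M) ℝ) : (sampleCov Y).PosSemidef := by
  have := (posSemidef_self_mul_conjTranspose (Y - meanMatrix Y)).smul
    (by positivity : (0 : ℝ) ≤ (M : ℝ)⁻¹)
  rwa [conjTranspose_eq_transpose_of_trivial] at this

theorem isUnit_sampleCov {Y : Matrix (Fin n) (Fin M) ℝ} (hY : (sampleCov Y).rank = n) :
    IsUnit (sampleCov Y) := by
  rw [← Matrix.mulVec_surjective_iff_isUnit]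
  have h : LinearMap.range (sampleCov Y).mulVecLin = ⊤ :=
    Submodule.eq_top_of_finrank_eq (hY.trans (by simp))
  exact LinearMap.range_eq_top.1 h

theorem sampleCov_posDef {Y : Matrix (Fin n) (Fin M) ℝ} (hY : (sampleCov Y).rank = n) :
    (sampleCov Y).PosDef :=
  (sampleCov_posSemidef Y).posDef_iff_isUnit.2 (isUnit_sampleCov hY)

theorem pos_of_rank_sampleCov (hn : 0 < n) {Y : Matrix (Fin n) (Fin M) ℝ}
    (hY : (sampleCov Y).rank = n) : 0 < M := by
  rcases Nat.eq_zero_or_pos M with rfl | h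
  · simp [sampleCov] at hY
    omega
  · exact h

theorem targetVar_pos {Y : Matrix (Fin n) (Fin M) ℝ} (hY : (sampleCov Y).rank = n) (i : Fin n) :
    0 < targetVar Y i := by
  rw [← sampleCov_diag]
  exact (sampleCov_posDef hY).diag_pos

theorem trace_sampleCov (Y : Matrix (Fin n) (Fin M) ℝ) :
    (sampleCov Y).trace = ∑ i, targetVar Y i :=
  Finset.sum_congr rfl fun i _ => sampleCov_diag Y i

theorem trace_sampleCorr {Y : Matrix (Fin n) (Fin M) ℝ} (hY : (sampleCov Y).rank = n) :
    (sampleCorr Y).trace = n := by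
  have h (i : Fin n) : sampleCorr Y i i = 1 := by
    have h1 := Real.mul_self_sqrt (targetVar_pos hY i).le
    have h2 := (Real.sqrt_pos.2 (targetVar_pos hY i)).ne'
    rw [sampleCorr, invStdMatrix, mul_diagonal, diagonal_mul, sampleCov_diag]
    field_simp
    rw [sq, h1]
  simp [Matrix.trace, h]

theorem trace_sampleCov_eq_mul_eigAvg (hn : 0 < n) (Y : Matrix (Fin n) (Fin M) ℝ) :
    (sampleCov Y).trace = n * eigAvg (sampleCov_isHermitian Y) := by
  have : (n : ℝ) ≠ 0 := by positivity
  rw [eigAvg, mul_div_cancel₀ _ this]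
  simpa using (sampleCov_isHermitian Y).trace_eq_sum_eigenvalues

theorem eigMin_le {A : Matrix (Fin n) (Fin n) ℝ} (hA : A.IsHermitian) (i : Fin n) :
    eigMin hA ≤ hA.eigenvalues i :=
  ciInf_le (Set.finite_range _).bddBelow i

theorem le_eigMax {A : Matrix (Fin n) (Fin n) ℝ} (hA : A.IsHermitian) (i : Fin n) :
    hA.eigenvalues i ≤ eigMax hA :=
  le_ciSup (Set.finite_range _).bddAbove i

/-- The eigenvalues of $P$ average to 1. With this, $c<\tilde\lambda_{\min}$ also puts the whitened
problem in the weak regime. -/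
theorem eigMin_sampleCorr_le_one (hn : 0 < n) {Y : Matrix (Fin n) (Fin M) ℝ}
    (hY : (sampleCov Y).rank = n) : eigMin (sampleCorr_isHermitian Y) ≤ 1 := by
  have h := (sampleCorr_isHermitian Y).trace_eq_sum_eigenvalues
  have h1 := Finset.card_nsmul_le_sum Finset.univ _ _
    fun i _ => eigMin_le (sampleCorr_isHermitian Y) i
  rw [trace_sampleCorr hY] at h
  simp only [RCLike.ofReal_real_eq_id, id] at h
  rw [← h] at h1
  simp only [Finset.card_univ, Fintype.card_fin, nsmul_eq_mul] at h1
  have : (0 : ℝ) < n := by exact_mod_cast hn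
  nlinarith

/-- The same average, used to put the whitened problem in the strong regime. -/
theorem one_le_eigMax_sampleCorr (hn : 0 < n) {Y : Matrix (Fin n) (Fin M) ℝ}
    (hY : (sampleCov Y).rank = n) : 1 ≤ eigMax (sampleCorr_isHermitian Y) := by
  have h := (sampleCorr_isHermitian Y).trace_eq_sum_eigenvalues
  have h1 := Finset.sum_le_card_nsmul Finset.univ _ _
    fun i _ => le_eigMax (sampleCorr_isHermitian Y) i
  rw [trace_sampleCorr hY] at h
  simp only [RCLike.ofReal_real_eq_id, id] at h
  rw [← h] at h1
  simp only [Finset.card_univ, Fintype.card_fin, nsmul_eq_mul] at h1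
  have : (0 : ℝ) < n := by exact_mod_cast hn
  nlinarith

theorem eigenvalues_eq_one {A : Matrix (Fin n) (Fin n) ℝ} (hA : A.IsHermitian) (h1 : A = 1)
    (i : Fin n) : hA.eigenvalues i = 1 := by
  subst h1
  have h := hA.mulVec_eigenvectorBasis i
  rw [Matrix.one_mulVec] at h
  have hne : (⇑(hA.eigenvectorBasis i) : Fin n → ℝ) ≠ 0 := fun h0 =>
    hA.eigenvectorBasis.orthonormal.ne_zero i (by ext j; exact congrFun h0 j)
  by_contra hv
  refine hne ((smul_eq_zero.1 ?_).resolve_left (sub_ne_zero.2 hv))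
  rw [sub_smul, one_smul, ← h, sub_self]

/-! ### Whitened and normalized targets -/

theorem sqrt_mul_sqrt_sampleCov (Y : Matrix (Fin n) (Fin M) ℝ) :
    CFC.sqrt (sampleCov Y) * CFC.sqrt (sampleCov Y) = sampleCov Y :=
  CFC.sqrt_mul_sqrt_self _ (sampleCov_posSemidef Y).nonneg

theorem transpose_sqrt_sampleCov (Y : Matrix (Fin n) (Fin M) ℝ) :
    (CFC.sqrt (sampleCov Y))ᵀ = CFC.sqrt (sampleCov Y) := by
  have := (CFC.sqrt_nonneg (sampleCov Y)).isSelfAdjoint.star_eq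
  rwa [Matrix.star_eq_conjTranspose, conjTranspose_eq_transpose_of_trivial] at this

theorem isUnit_det_sqrt_sampleCov {Y : Matrix (Fin n) (Fin M) ℝ}
    (hY : (sampleCov Y).rank = n) : IsUnit (CFC.sqrt (sampleCov Y)).det := by
  have h := (Matrix.isUnit_iff_isUnit_det _).1 (isUnit_sampleCov hY)
  rw [← sqrt_mul_sqrt_sampleCov, det_mul] at h
  exact isUnit_of_mul_isUnit_left h

theorem sqrt_mul_whiten {Y : Matrix (Fin n) (Fin M) ℝ} (hY : (sampleCov Y).rank = n) :
    CFC.sqrt (sampleCov Y) * whiten Y = Y - meanMatrix Y :=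
  Matrix.mul_nonsing_inv_cancel_left _ _ (isUnit_det_sqrt_sampleCov hY)

theorem cov_whiten {Y : Matrix (Fin n) (Fin M) ℝ} (hY : (sampleCov Y).rank = n) :
    (M : ℝ)⁻¹ • (whiten Y * (whiten Y)ᵀ) = 1 := by
  have hu := isUnit_det_sqrt_sampleCov hY
  calc _ = (CFC.sqrt (sampleCov Y))⁻¹ * sampleCov Y * (CFC.sqrt (sampleCov Y))⁻¹ := by
        rw [whiten, Matrix.transpose_mul, Matrix.transpose_nonsing_inv, transpose_sqrt_sampleCov]
        -- Keeps the unfolding of `sampleCov` from reaching inside the root.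
        generalize (CFC.sqrt (sampleCov Y))⁻¹ = A
        simp only [sampleCov, Matrix.mul_assoc, Matrix.mul_smul, Matrix.smul_mul]
    _ = 1 := by
        nth_rewrite 2 [← sqrt_mul_sqrt_sampleCov]
        rw [Matrix.nonsing_inv_mul_cancel_left _ _ hu, Matrix.mul_nonsing_inv _ hu]

theorem stdMatrix_mul_normalize {Y : Matrix (Fin n) (Fin M) ℝ} (hY : (sampleCov Y).rank = n) :
    stdMatrix Y * normalize Y = Y - meanMatrix Y := by
  rw [stdMatrix, normalize, invStdMatrix, ← Matrix.mul_assoc, diagonal_mul_diagonal]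
  simp [mul_inv_cancel₀ (Real.sqrt_pos.2 (targetVar_pos hY _)).ne']

theorem cov_normalize (Y : Matrix (Fin n) (Fin M) ℝ) :
    (M : ℝ)⁻¹ • (normalize Y * (normalize Y)ᵀ) = sampleCorr Y := by
  simp [normalize, sampleCorr, sampleCov, invStdMatrix, Matrix.mul_assoc]

/-- $V$ and $\Sigma$ share their diagonal. With `frobSq_sqrt_sampleCov`, this is why the two
back-transformed errors agree in the weak regime. -/
theorem frobSq_stdMatrix (Y : Matrix (Fin n) (Fin M) ℝ) :
    frobSq (stdMatrix Y) = (sampleCov Y).trace := by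
  rw [frobSq_eq_trace, stdMatrix, diagonal_transpose, diagonal_mul_diagonal, trace_diagonal,
    trace_sampleCov]
  refine Finset.sum_congr rfl fun i _ => Real.mul_self_sqrt ?_
  rw [← sampleCov_diag]
  exact (sampleCov_posSemidef Y).diag_nonneg

theorem frobSq_sqrt_sampleCov (Y : Matrix (Fin n) (Fin M) ℝ) :
    frobSq (CFC.sqrt (sampleCov Y)) = (sampleCov Y).trace := by
  rw [frobSq_eq_trace, transpose_sqrt_sampleCov, sqrt_mul_sqrt_sampleCov]

theorem frobSq_one : frobSq (1 : Matrix (Fin n) (Fin n) ℝ) = n := by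
  simp [frobSq_eq_trace]

/-! ### Training errors -/

/-- Weak regularization: the training error after the linear back-transformation `B`. -/
theorem IsMinimizerNoBias.mse_of_le_eigenvalues {lH lW : ℝ} (hM : 0 < M) (hlH : 0 < lH)
    (hlW : 0 < lW) (hnd : n ≤ d) {T : Matrix (Fin n) (Fin M) ℝ} {S : Matrix (Fin n) (Fin n) ℝ}
    (hTS : (M : ℝ)⁻¹ • (T * Tᵀ) = S) (hS : S.IsHermitian)
    (hc : ∀ i, lH * lW ≤ hS.eigenvalues i)
    {H : Matrix (Fin d) (Fin M) ℝ} {W : Matrix (Fin n) (Fin d) ℝ}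
    (h : IsMinimizerNoBias lH lW T H W) (B : Matrix (Fin n) (Fin n) ℝ) :
    (M : ℝ)⁻¹ * frobSq (B * (W * H - T)) = lH * lW * frobSq B := by
  have hM' : (M : ℝ) ≠ 0 := by positivity
  obtain ⟨Q, hQ, hres⟩ := h.exists_residual_eq hM hlH hlW hnd hTS hS hc
  rw [hres, Matrix.mul_neg, frobSq_neg, Matrix.mul_smul, frobSq_smul,
    frobSq_mul_of_mul_transpose_eq_one _ hQ, Real.sq_sqrt (by positivity)]
  field_simp

/-- Puts the error in the form $B(WH-T)$ required by `IsMinimizerNoBias.mse_of_le_eigenvalues`. -/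
theorem mse_deWhiten {Y : Matrix (Fin n) (Fin M) ℝ} (hY : (sampleCov Y).rank = n)
    (Z : Matrix (Fin n) (Fin M) ℝ) :
    mse (deWhiten Y Z) Y = (M : ℝ)⁻¹ * frobSq (CFC.sqrt (sampleCov Y) * (Z - whiten Y)) := by
  rw [mse, deWhiten, Matrix.mul_sub, sqrt_mul_whiten hY]
  congr 2
  abel

theorem mse_deNormalize {Y : Matrix (Fin n) (Fin M) ℝ} (hY : (sampleCov Y).rank = n)
    (Z : Matrix (Fin n) (Fin M) ℝ) :
    mse (deNormalize Y Z) Y = (M : ℝ)⁻¹ * frobSq (stdMatrix Y * (Z - normalize Y)) := by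
  rw [mse, deNormalize, Matrix.mul_sub, stdMatrix_mul_normalize hY]
  congr 2
  abel

/-- The training error of an optimal model is at most the total variance of the targets. -/
theorem IsMinimizer.mse_le {lH lW : ℝ} (hM : 0 < M) (hlH : 0 ≤ lH) (hlW : 0 ≤ lW)
    {Y : Matrix (Fin n) (Fin M) ℝ} {H : Matrix (Fin d) (Fin M) ℝ} {W : Matrix (Fin n) (Fin d) ℝ}
    {b : Fin n → ℝ} (h : IsMinimizer lH lW Y H W b) :
    mse (predict H W b) Y ≤ mse (meanMatrix Y) Y := by
  have hM' : (0 : ℝ) < M := by exact_mod_cast hM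
  -- The competitor predicts the mean at no regularization cost.
  have hle := h 0 0 (targetMean Y)
  simp only [loss, predict_targetMean, Matrix.zero_mul, zero_add, frobSq_zero, mul_zero,
    add_zero] at hle
  have h1 := mul_nonneg (by positivity : 0 ≤ lH / (2 * M)) (frobSq_nonneg H)
  have h2 := mul_nonneg (by positivity : 0 ≤ lW / 2) (frobSq_nonneg W)
  have h3 : 1 / (2 * M) * frobSq (predict H W b - Y) ≤
      1 / (2 * M) * frobSq (meanMatrix Y - Y) := by linarith
  exact mul_le_mul_of_nonneg_left (le_of_mul_le_mul_left h3 (by positivity)) (by positivity)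

end UFM

/-! ### Comparison of the three training errors -/

theorem theorem5p4 {n M : ℕ} (d : ℕ) (hn : 0 < n) (Y : Matrix (Fin n) (Fin M) ℝ)
    (hY : (UFM.sampleCov Y).rank = n)
    (lH lW c : ℝ) (hlH : 0 ≤ lH) (hlW : 0 ≤ lW) (hc : c = lH * lW) :
    -- optimal models exist, so that the mean squared errors compared below exist
    (0 < c →
      (∃ m, UFM.IsMSERaw d lH lW Y m) ∧
      (∃ m, UFM.IsMSEDeWhiten d lH lW Y m) ∧
      (∃ m, UFM.IsMSEDeNormalize d lH lW Y m)) ∧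
    -- part (i)
    (n ≤ d → 0 < c →
      c < min (UFM.eigMin (UFM.sampleCov_isHermitian Y))
        (UFM.eigMin (UFM.sampleCorr_isHermitian Y)) →
      ∀ mRaw mWhiten mNorm : ℝ,
        UFM.IsMSERaw d lH lW Y mRaw →
        UFM.IsMSEDeWhiten d lH lW Y mWhiten →
        UFM.IsMSEDeNormalize d lH lW Y mNorm →
        mNorm = mWhiten ∧
        (UFM.eigAvg (UFM.sampleCov_isHermitian Y) < 1 → mNorm < mRaw) ∧
        (1 < UFM.eigAvg (UFM.sampleCov_isHermitian Y) → mRaw < mNorm) ∧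
        (UFM.eigAvg (UFM.sampleCov_isHermitian Y) = 1 → mNorm = mRaw)) ∧
    -- part (ii)
    (UFM.eigMax (UFM.sampleCorr_isHermitian Y) < c →
      ∀ mRaw mWhiten mNorm : ℝ,
        UFM.IsMSERaw d lH lW Y mRaw →
        UFM.IsMSEDeWhiten d lH lW Y mWhiten →
        UFM.IsMSEDeNormalize d lH lW Y mNorm →
        mNorm = mWhiten ∧ mRaw ≤ mNorm) := by
  have hM := UFM.pos_of_rank_sampleCov hn hY
  subst hc
  refine ⟨fun hc => ?_, fun hnd hc hlt => ?_, fun hlt => ?_⟩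
  · have hlH' : 0 < lH := pos_of_mul_pos_left hc hlW
    have hlW' : 0 < lW := pos_of_mul_pos_right hc hlH
    refine ⟨?_, ?_, ?_⟩
    · obtain ⟨H, W, h⟩ := UFM.exists_isMinimizerNoBias d hM hlH' hlW' (Y - UFM.meanMatrix Y)
      exact ⟨_, H, W, _, h.isMinimizer hM hlH, rfl⟩
    · obtain ⟨H, W, h⟩ := UFM.exists_isMinimizerNoBias d hM hlH' hlW' (UFM.whiten Y)
      exact ⟨_, H, W, h, rfl⟩
    · obtain ⟨H, W, h⟩ := UFM.exists_isMinimizerNoBias d hM hlH' hlW' (UFM.normalize Y)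
      exact ⟨_, H, W, h, rfl⟩
  · rintro _ _ _ ⟨H₁, W₁, b, h₁, rfl⟩ ⟨H₂, W₂, h₂, rfl⟩ ⟨H₃, W₃, h₃, rfl⟩
    have hlH' : 0 < lH := pos_of_mul_pos_left hc hlW
    have hlW' : 0 < lW := pos_of_mul_pos_right hc hlH
    obtain ⟨hltC, hltP⟩ := lt_min_iff.1 hlt
    -- Here the back-transformation is the identity, with $\|I\|_F^2=n$.
    have hRaw : UFM.mse (UFM.predict H₁ W₁ b) Y = lH * lW * n := by
      rw [UFM.mse, h₁.predict_sub hM hlH, ← UFM.frobSq_one (n := n), ←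
        (h₁.centered hM hlH).mse_of_le_eigenvalues hM hlH' hlW' hnd rfl
          (UFM.sampleCov_isHermitian Y) (fun i => (hltC.trans_le (UFM.eigMin_le _ i)).le) 1,
        Matrix.one_mul]
    have hWhiten : UFM.mse (UFM.deWhiten Y (W₂ * H₂)) Y = lH * lW * (UFM.sampleCov Y).trace := by
      rw [UFM.mse_deWhiten hY, ← UFM.frobSq_sqrt_sampleCov]
      refine h₂.mse_of_le_eigenvalues hM hlH' hlW' hnd (UFM.cov_whiten hY)
        Matrix.isHermitian_one (fun i => ?_) _
      rw [UFM.eigenvalues_eq_one _ rfl]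
      exact (hltP.trans_le (UFM.eigMin_sampleCorr_le_one hn hY)).le
    have hNorm : UFM.mse (UFM.deNormalize Y (W₃ * H₃)) Y =
        lH * lW * (UFM.sampleCov Y).trace := by
      rw [UFM.mse_deNormalize hY, ← UFM.frobSq_stdMatrix]
      exact h₃.mse_of_le_eigenvalues hM hlH' hlW' hnd (UFM.cov_normalize Y)
        (UFM.sampleCorr_isHermitian Y) (fun i => (hltP.trans_le (UFM.eigMin_le _ i)).le) _
    have hcn : 0 < lH * lW * n := mul_pos hc (by exact_mod_cast hn)
    rw [hRaw, hWhiten, hNorm, UFM.trace_sampleCov_eq_mul_eigAvg hn, ← mul_assoc]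
    refine ⟨rfl, fun h => ?_, fun h => ?_, fun h => ?_⟩
    · exact mul_lt_of_lt_one_right hcn h
    · exact lt_mul_of_one_lt_right hcn h
    · rw [h, mul_one]
  · rintro _ _ _ ⟨H₁, W₁, b, h₁, rfl⟩ ⟨H₂, W₂, h₂, rfl⟩ ⟨H₃, W₃, h₃, rfl⟩
    -- $c>1$ gives both $\lambda_H>0$ and the strong regime for the whitened targets.
    have h1 := (UFM.one_le_eigMax_sampleCorr hn hY).trans_lt hlt
    have hlH' : 0 < lH := pos_of_mul_pos_left (zero_lt_one.trans h1) hlW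
    have hW : W₂ * H₂ = 0 := h₂.mul_eq_zero hM hlH' (UFM.cov_whiten hY) Matrix.isHermitian_one
      fun i => by rw [UFM.eigenvalues_eq_one _ rfl]; exact h1.le
    have hN : W₃ * H₃ = 0 := h₃.mul_eq_zero hM hlH' (UFM.cov_normalize Y)
      (UFM.sampleCorr_isHermitian Y) fun i => (UFM.le_eigMax _ i).trans hlt.le
    rw [hW, hN, UFM.deWhiten, UFM.deNormalize, Matrix.mul_zero, Matrix.mul_zero, zero_add]
    exact ⟨rfl, h₁.mse_le hM hlH hlW⟩
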